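/- Let $N\ge 1$ be an integer and let $(\Phi(t))_{t\ge 0}$ be a continuous semiflow on a metrizable space $X$ that is an extended dissipative system on $\mathbb{R}^N$. This means that to each $u\in X$ are associated continuous functions $e=e_u\colon\mathbb{R}^N\to[0,\infty)$ (energy density), $f=f_u\colon\mathbb{R}^N\to\mathbb{R}^N$ (flux) and $d=d_u\colon\mathbb{R}^N\to[0,\infty)$ (dissipation rate) such that: (A1) $e,f,d$ depend continuously on $u\in X$, uniformly on compact subsets of $\mathbb{R}^N$; (A2) $|f|^2\le b(e)\,d$ for some nondecreasing function $b\colon[0,\infty)\to[0,\infty)$ that does not depend on $u$; (A3) if $d_u\equiv 0$, then $\Phi(t)u=u$ for all $t\ge 0$; (A4) for every $u\in X$, the functions $e(x,t)=e_{\Phi(t)u}(x)$, $f(x,t)=f_{\Phi(t)u}(x)$, $d(x,t)=d_{\Phi(t)u}(x)$ satisfy $\partial_t e=\operatorname{div}_x f-d$ in the sense of distributions on $\mathbb{R}^N\times(0,\infty)$. Let $u_0\in X$, let $e(x,t)$, $d(x,t)$ be the quantities associated with the trajectory $\Phi(t)u_0$, and suppose that $$ e_0=\sup_{x\in\mathbb{R}^N}e(x,0),\qquad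 \beta=\sup_{x\in\mathbb{R}^N}\,\sup_{t\ge 0}\,b(e(x,t)) $$ are finite and strictly positive. Then, for all $R_0>0$ and $T>0$, $$ \frac{N}{\omega_N R_0^N T^{N/2}}\int_0^T\!\int_{B_{R_0\sqrt T}} d(x,t)\,dx\,dt\;\le\; e_0\left(\tilde h_N\Bigl(R_0\sqrt{\tfrac{e_0}{\beta}}\Bigr)+1\right). $$ Here $B_R=\{x\in\mathbb{R}^N : |x|<R\}$, $\omega_N=2\pi^{N/2}/\Gamma(N/2)$, $\tilde h_N(r)=N h_N(r)/r$, and $$ h_N(r)=\frac{K_{N/2}(r)}{K_{N/2-1}(r)},\qquad r>0, $$ where $K_\nu(r)=\int_0^\infty e^{-r\cosh t}\cosh(\nu t)\,dt$ is the modified Bessel function of the second kind. -/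

import Mathlib

open Set MeasureTheory
open scoped NNReal ContDiff

noncomputable section

/-- Euclidean space `ℝ^N`. -/
abbrev Space (N : ℕ) : Type := EuclideanSpace ℝ (Fin N)

/-- The balance law `∂ₜ e = div f - d` in the sense of distributions on `ℝ^N × (0,∞)`: for every
smooth test function `φ` with compact support in `ℝ^N × (0,∞)`,
`∫∫ (e ∂ₜφ - f · ∇φ - d φ) dx dt = 0`. -/
def DistributionalBalance {N : ℕ} (e : Space N → ℝ≥0 → ℝ) (f : Space N → ℝ≥0 → Space N)
    (d : Space N → ℝ≥0 → ℝ) : Prop :=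
  ∀ φ : Space N × ℝ → ℝ, ContDiff ℝ ∞ φ → HasCompactSupport φ →
    tsupport φ ⊆ {p | 0 < p.2} →
    ∫ p in (univ : Set (Space N)) ×ˢ Ioi (0 : ℝ),
      (e p.1 p.2.toNNReal * fderiv ℝ φ p (0, 1)
        - fderiv ℝ φ p (f p.1 p.2.toNNReal, 0)
        - d p.1 p.2.toNNReal * φ p) = 0

/-- The continuous semiflow `Φ` on `X`, together with the energy density `e`, the flux `f`, the
dissipation rate `d` associated with each `u : X`, and the function `b`, is an extended
dissipative system on `ℝ^N`. The spaces `C(Space N, _)` carry the compact-open topology, that is,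
uniform convergence on compact sets. -/
structure IsExtendedDissipativeSystem {N : ℕ} {X : Type*} [TopologicalSpace X]
    (Φ : Flow ℝ≥0 X) (e : X → C(Space N, ℝ)) (f : X → C(Space N, Space N))
    (d : X → C(Space N, ℝ)) (b : ℝ → ℝ) : Prop where
  e_nonneg : ∀ u x, 0 ≤ e u x
  d_nonneg : ∀ u x, 0 ≤ d u x
  continuous_e : Continuous e
  continuous_f : Continuous f
  continuous_d : Continuous d
  b_nonneg : ∀ s, 0 ≤ s → 0 ≤ b s
  b_mono : MonotoneOn b (Ici 0)
  flux_bound : ∀ u x, ‖f u x‖ ^ 2 ≤ b (e u x) * d u x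
  equilibrium : ∀ u, (∀ x, d u x = 0) → ∀ t, Φ t u = u
  balance : ∀ u, DistributionalBalance (fun x t => e (Φ t u) x) (fun x t => f (Φ t u) x)
    (fun x t => d (Φ t u) x)

/-- The surface measure of the unit sphere of `ℝ^N`. -/
def sphereArea (N : ℕ) : ℝ := 2 * Real.pi ^ ((N : ℝ) / 2) / Real.Gamma ((N : ℝ) / 2)

/-- The modified Bessel function of the second kind `K_ν(r)`, `r > 0`. -/
def besselK (ν r : ℝ) : ℝ := ∫ t in Ioi (0 : ℝ), Real.exp (-r * Real.cosh t) * Real.cosh (ν * t)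

/-- `h_N = K_{N/2} / K_{N/2-1}`, the positive solution of `h' + (N-1) h / r = h^2 - 1` on
`(0,∞)`. -/
def besselRatio (N : ℕ) (r : ℝ) : ℝ := besselK ((N : ℝ) / 2) r / besselK ((N : ℝ) / 2 - 1) r

/-- `N h_N(r) / r`. -/
def besselRatioTilde (N : ℕ) (r : ℝ) : ℝ := N * besselRatio N r / r

end

open Filter Topology

/-! Test the balance law against `p ^ 2`, where `p` is a cutoff in space, constant on the ball of
radius `R = R₀ * √T`. The flux contributes `2 p ∇p · f`, and `‖f‖ ^ 2 ≤ β d` gives `2 |p ∇p · f| ≤ d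
p ^ 2 + β |∇p| ^ 2`. Outside the ball the dissipation absorbs the first term; inside, `∇p = 0` and
the dissipation survives. Hence, if `p = 1` on the ball, the dissipation there is at most `∫ (e₀ p ^
2 + β T |∇p| ^ 2)` (`dissipation_le_of_cutoff`).

Minimising the right side leads to `Δp = k ^ 2 p` outside the ball, with `k ^ 2 = e₀ / (β T)`. The
decaying radial solution is a Bessel profile, and integration by parts reduces its exterior energy
to a boundary term proportional to `-g'(R) = k h_N(k R)` (`exists_radial_profile`). The interior
contributes the summand `1` of the bound. This profile is neither smooth across the sphere nor
compactly supported, so it is composed with a 1-Lipschitz truncation, which does not raise the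
energy and lowers the plateau by at most `4 * ε` (`exists_cutoff`); then `ε → 0`. -/

/-! ### Bessel functions of the second kind. -/

theorem isBigO_exp_neg_mul_cosh {r : ℝ} (hr : 0 < r) (ν : ℝ) :
    (fun t : ℝ => Real.exp (-r * Real.cosh t) * Real.cosh (ν * t)) =O[atTop]
      fun t => Real.exp (-1 * t) := by
  refine Asymptotics.IsBigO.of_bound 1 ?_
  -- Beyond this threshold `r t ^ 2 / 4 ≥ (|ν| + 1) t`, so `cosh t ≥ t ^ 2 / 4` beats the growth
  -- `exp (|ν| t)` with `exp (-t)` to spare.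
  filter_upwards [eventually_ge_atTop (4 * (|ν| + 1) / r), eventually_ge_atTop 0] with t ht ht0
  have h1 : Real.cosh (ν * t) ≤ Real.exp (|ν| * t) := by
    rw [← Real.cosh_abs, abs_mul, abs_of_nonneg ht0, Real.cosh_eq]
    have : Real.exp (-(|ν| * t)) ≤ Real.exp (|ν| * t) :=
      Real.exp_le_exp.2 (by have := mul_nonneg (abs_nonneg ν) ht0; linarith)
    linarith
  have h2 : t ^ 2 / 4 ≤ Real.cosh t := by
    have := Real.quadratic_le_exp_of_nonneg ht0
    have := Real.exp_pos (-t)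
    rw [Real.cosh_eq]
    linarith
  rw [Real.norm_of_nonneg (mul_nonneg (Real.exp_nonneg _) (Real.cosh_pos _).le),
    Real.norm_of_nonneg (Real.exp_nonneg _), one_mul]
  calc _ ≤ Real.exp (-r * Real.cosh t) * Real.exp (|ν| * t) := by gcongr
    _ = Real.exp (-r * Real.cosh t + |ν| * t) := (Real.exp_add _ _).symm
    _ ≤ _ := Real.exp_le_exp.2 (by
      have h3 : 4 * (|ν| + 1) ≤ t * r := (div_le_iff₀ hr).1 ht
      nlinarith [mul_le_mul_of_nonneg_left h3 ht0, mul_le_mul_of_nonneg_left h2 hr.le])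

theorem integrableOn_besselK {r : ℝ} (hr : 0 < r) (ν : ℝ) :
    IntegrableOn (fun t : ℝ => Real.exp (-r * Real.cosh t) * Real.cosh (ν * t)) (Ioi 0) :=
  integrable_of_isBigO_exp_neg one_pos (by fun_prop) (isBigO_exp_neg_mul_cosh hr ν)

theorem cosh_mul_cosh_mul (ν t : ℝ) :
    Real.cosh t * Real.cosh (ν * t) =
      (Real.cosh ((ν + 1) * t) + Real.cosh ((ν - 1) * t)) / 2 := by
  rw [add_mul, sub_mul, one_mul, Real.cosh_add, Real.cosh_sub]; ring

theorem sinh_mul_sinh_mul (ν t : ℝ) :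
    Real.sinh t * Real.sinh (ν * t) =
      (Real.cosh ((ν + 1) * t) - Real.cosh ((ν - 1) * t)) / 2 := by
  rw [add_mul, sub_mul, one_mul, Real.cosh_add, Real.cosh_sub]; ring

/-- Differentiation under the integral; the factor `cosh t` is absorbed by the product formula for
`cosh`. The integrands at `r / 2` dominate for all parameters above `r / 2`. -/
theorem hasDerivAt_besselK_symm {r : ℝ} (hr : 0 < r) (ν : ℝ) :
    HasDerivAt (besselK ν) (-(besselK (ν + 1) r + besselK (ν - 1) r) / 2) r := by
  have key := hasDerivAt_integral_of_dominated_loc_of_deriv_le (μ := volume.restrict (Ioi (0 : ℝ)))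
    (F := fun r t => Real.exp (-r * Real.cosh t) * Real.cosh (ν * t)) (x₀ := r)
    (F' := fun r t => Real.exp (-r * Real.cosh t) * (-Real.cosh t) * Real.cosh (ν * t))
    (s := Ioi (r / 2))
    (bound := fun t => (Real.exp (-(r / 2) * Real.cosh t) * Real.cosh ((ν + 1) * t) +
      Real.exp (-(r / 2) * Real.cosh t) * Real.cosh ((ν - 1) * t)) / 2)
    (Ioi_mem_nhds (by linarith))
    (Eventually.of_forall fun x => (by fun_prop : Continuous _).aestronglyMeasurable)
    (integrableOn_besselK hr ν)
    ((by fun_prop : Continuous _).aestronglyMeasurable)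
    (Eventually.of_forall fun t x hx => ?_)
    (((integrableOn_besselK (half_pos hr) _).add (integrableOn_besselK (half_pos hr) _)).div_const 2)
    (Eventually.of_forall fun t x hx => ?_)
  · refine key.2.congr_deriv ?_
    have : ∀ t, Real.exp (-r * Real.cosh t) * (-Real.cosh t) * Real.cosh (ν * t) =
        -(Real.exp (-r * Real.cosh t) * Real.cosh ((ν + 1) * t) +
          Real.exp (-r * Real.cosh t) * Real.cosh ((ν - 1) * t)) / 2 := fun t => by
      linear_combination (-Real.exp (-r * Real.cosh t)) * cosh_mul_cosh_mul ν t
    simp only [this]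
    rw [integral_div, integral_neg,
      integral_add (integrableOn_besselK hr _) (integrableOn_besselK hr _)]
    rfl
  · have h : Real.exp (-x * Real.cosh t) ≤ Real.exp (-(r / 2) * Real.cosh t) :=
      Real.exp_le_exp.2 (by
        have : r / 2 < x := hx
        nlinarith [Real.cosh_pos t])
    rw [mul_assoc, neg_mul (Real.cosh t), mul_neg, norm_neg, cosh_mul_cosh_mul]
    have h0 : 0 ≤ (Real.cosh ((ν + 1) * t) + Real.cosh ((ν - 1) * t)) / 2 := by
      have := Real.cosh_pos ((ν + 1) * t)
      have := Real.cosh_pos ((ν - 1) * t)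
      linarith
    rw [Real.norm_of_nonneg (mul_nonneg (Real.exp_nonneg _) h0), ← mul_add, mul_div_assoc]
    gcongr
  · have : HasDerivAt (fun x : ℝ => -x * Real.cosh t) (-Real.cosh t) x := by
      simpa using (hasDerivAt_id x).neg.mul_const (Real.cosh t)
    exact this.exp.mul_const _

/-- The function `exp (-r cosh t) sinh (ν t)` vanishes at `0` and at infinity, so its derivative
integrates to zero. -/
theorem besselK_recurrence {r : ℝ} (hr : 0 < r) (ν : ℝ) :
    r * (besselK (ν + 1) r - besselK (ν - 1) r) = 2 * ν * besselK ν r := by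
  have hd : ∀ t ∈ Ici (0 : ℝ), HasDerivAt (fun t => Real.exp (-r * Real.cosh t) * Real.sinh (ν * t))
      (ν * (Real.exp (-r * Real.cosh t) * Real.cosh (ν * t)) -
        r / 2 * (Real.exp (-r * Real.cosh t) * Real.cosh ((ν + 1) * t) -
          Real.exp (-r * Real.cosh t) * Real.cosh ((ν - 1) * t))) t := fun t _ => by
    have h1 := ((Real.hasDerivAt_cosh t).const_mul (-r)).exp
    have h2 : HasDerivAt (fun t => Real.sinh (ν * t)) (Real.cosh (ν * t) * ν) t := by
      simpa using ((hasDerivAt_id t).const_mul ν).sinh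
    refine (h1.mul h2).congr_deriv ?_
    linear_combination (-r * Real.exp (-r * Real.cosh t)) * sinh_mul_sinh_mul ν t
  have ht : Tendsto (fun t => Real.exp (-r * Real.cosh t) * Real.sinh (ν * t)) atTop (𝓝 0) := by
    have h0 : Tendsto (fun t : ℝ => Real.exp (-1 * t)) atTop (𝓝 0) := by
      simpa using Real.tendsto_exp_neg_atTop_nhds_zero
    refine Asymptotics.IsBigO.trans_tendsto ?_ h0
    refine Asymptotics.IsBigO.trans ?_ (isBigO_exp_neg_mul_cosh hr ν)
    refine Asymptotics.isBigO_of_le _ fun t => ?_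
    rw [norm_mul, norm_mul]
    gcongr
    rw [Real.norm_eq_abs, Real.norm_eq_abs, Real.abs_sinh, abs_of_pos (Real.cosh_pos _),
      ← Real.cosh_abs (ν * t)]
    exact (Real.sinh_lt_cosh _).le
  have hi1 := (integrableOn_besselK hr ν).const_mul ν
  have hi2 := ((integrableOn_besselK hr (ν + 1)).sub (integrableOn_besselK hr (ν - 1))).const_mul
    (r / 2)
  have key := integral_Ioi_of_hasDerivAt_of_tendsto' hd (hi1.sub hi2) ht
  have hs := integral_sub hi1 hi2
  simp only [Pi.sub_apply] at hs
  rw [hs, integral_const_mul, integral_const_mul,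
    integral_sub (integrableOn_besselK hr _) (integrableOn_besselK hr _)] at key
  simp only [besselK]
  simp at key
  simp only [neg_mul] at key ⊢
  linarith

theorem hasDerivAt_besselK {r : ℝ} (hr : 0 < r) (ν : ℝ) :
    HasDerivAt (besselK ν) (ν / r * besselK ν r - besselK (ν + 1) r) r := by
  refine (hasDerivAt_besselK_symm hr ν).congr_deriv ?_
  have := besselK_recurrence hr ν
  field_simp
  linarith

theorem hasDerivAt_besselK_add_one {r : ℝ} (hr : 0 < r) (ν : ℝ) :
    HasDerivAt (besselK (ν + 1)) (-besselK ν r - (ν + 1) / r * besselK (ν + 1) r) r := by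
  refine (hasDerivAt_besselK_symm hr (ν + 1)).congr_deriv ?_
  have := besselK_recurrence hr (ν + 1)
  rw [add_sub_cancel_right] at *
  field_simp
  linarith

theorem besselK_pos {r : ℝ} (hr : 0 < r) (ν : ℝ) : 0 < besselK ν r := by
  refine (setIntegral_pos_iff_support_of_nonneg_ae
    (Eventually.of_forall fun t => mul_nonneg (Real.exp_nonneg _) (Real.cosh_pos _).le)
    (integrableOn_besselK hr ν)).2 ?_
  have : (Function.support fun t : ℝ => Real.exp (-r * Real.cosh t) * Real.cosh (ν * t)) = univ :=
    eq_univ_of_forall fun t => (mul_pos (Real.exp_pos _) (Real.cosh_pos _)).ne'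
  rw [this, univ_inter]
  simp

/-- The symmetric derivative formula stays within the family `K_ν` with constant coefficients, so
induction on the order of smoothness works for all `ν` at once. -/
theorem contDiffOn_besselK (ν : ℝ) : ContDiffOn ℝ ∞ (besselK ν) (Ioi 0) := by
  rw [contDiffOn_infty]
  intro n
  induction n generalizing ν with
  | zero =>
    exact contDiffOn_zero.2 fun r hr => (hasDerivAt_besselK_symm hr ν).continuousAt.continuousWithinAt
  | succ n ih =>
    push_cast
    rw [contDiffOn_succ_iff_deriv_of_isOpen isOpen_Ioi]
    refine ⟨fun r hr => (hasDerivAt_besselK_symm hr ν).differentiableAt.differentiableWithinAt,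
      by simp, ?_⟩
    exact (((ih (ν + 1)).add (ih (ν - 1))).neg.div_const 2).congr fun r hr =>
      (hasDerivAt_besselK_symm hr ν).deriv

theorem besselK_le_exp {r : ℝ} (hr : 1 ≤ r) (ν : ℝ) :
    besselK ν r ≤ Real.exp (1 - r) * besselK ν 1 := by
  rw [besselK, besselK, ← integral_const_mul]
  refine integral_mono (integrableOn_besselK (by linarith) ν)
    ((integrableOn_besselK one_pos ν).const_mul _) fun t => ?_
  dsimp only
  rw [← mul_assoc, ← Real.exp_add]
  gcongr
  nlinarith [Real.one_le_cosh t]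

/-! ### The radial Bessel profile and its energy. -/

/-- The radial solution `r ^ (1 - N / 2) * K_{N / 2 - 1}(r)` of `Δ ψ = ψ` on `ℝ^N ∖ {0}`. -/
noncomputable def besselProfile (N : ℕ) (r : ℝ) : ℝ :=
  r ^ (-((N : ℝ) / 2 - 1)) * besselK ((N : ℝ) / 2 - 1) r

/-- The derivative of `besselProfile`. -/
noncomputable def besselProfileDeriv (N : ℕ) (r : ℝ) : ℝ :=
  -(r ^ (-((N : ℝ) / 2 - 1)) * besselK ((N : ℝ) / 2) r)

theorem besselProfile_pos (N : ℕ) {r : ℝ} (hr : 0 < r) : 0 < besselProfile N r :=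
  mul_pos (Real.rpow_pos_of_pos hr _) (besselK_pos hr _)

theorem besselProfileDeriv_neg (N : ℕ) {r : ℝ} (hr : 0 < r) : besselProfileDeriv N r < 0 :=
  neg_lt_zero.2 (mul_pos (Real.rpow_pos_of_pos hr _) (besselK_pos hr _))

/-- The logarithmic derivative is the point where `h_N` enters the estimate. -/
theorem besselProfileDeriv_div_besselProfile (N : ℕ) {r : ℝ} (hr : 0 < r) :
    besselProfileDeriv N r / besselProfile N r = -besselRatio N r := by
  have h1 := (Real.rpow_pos_of_pos hr (-((N : ℝ) / 2 - 1))).ne'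
  have h2 := (besselK_pos hr ((N : ℝ) / 2 - 1)).ne'
  simp only [besselProfileDeriv, besselProfile, besselRatio]
  field_simp

theorem hasDerivAt_besselProfile (N : ℕ) {r : ℝ} (hr : 0 < r) :
    HasDerivAt (besselProfile N) (besselProfileDeriv N r) r := by
  refine ((Real.hasDerivAt_rpow_const (Or.inl hr.ne')).mul
    (hasDerivAt_besselK hr ((N : ℝ) / 2 - 1))).congr_deriv ?_
  rw [Real.rpow_sub_one hr.ne', sub_add_cancel, besselProfileDeriv]
  ring

theorem hasDerivAt_besselProfileDeriv (N : ℕ) {r : ℝ} (hr : 0 < r) :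
    HasDerivAt (besselProfileDeriv N)
      (besselProfile N r - (N - 1) / r * besselProfileDeriv N r) r := by
  have h := hasDerivAt_besselK_add_one hr ((N : ℝ) / 2 - 1)
  rw [sub_add_cancel] at h
  refine ((Real.hasDerivAt_rpow_const (p := -((N : ℝ) / 2 - 1))
    (Or.inl hr.ne')).mul h).neg.congr_deriv ?_
  rw [Real.rpow_sub_one hr.ne', besselProfileDeriv, besselProfile]
  ring

theorem contDiffOn_besselProfile (N : ℕ) : ContDiffOn ℝ ∞ (besselProfile N) (Ioi 0) :=
  ContDiffOn.mul (fun _ hr => (Real.contDiffAt_rpow_const_of_ne (ne_of_gt hr)).contDiffWithinAt)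
    (contDiffOn_besselK _)

theorem tendsto_besselProfile_atTop (N : ℕ) : Tendsto (besselProfile N) atTop (𝓝 0) := by
  have h := (tendsto_rpow_mul_exp_neg_mul_atTop_nhds_zero (-((N : ℝ) / 2 - 1)) 1 one_pos).mul_const
    (Real.exp 1 * besselK ((N : ℝ) / 2 - 1) 1)
  rw [zero_mul] at h
  refine squeeze_zero' ?_ ?_ h
  · filter_upwards [eventually_gt_atTop 0] with r hr using (besselProfile_pos N hr).le
  · filter_upwards [eventually_ge_atTop 1] with r hr
    calc besselProfile N r
        ≤ r ^ (-((N : ℝ) / 2 - 1)) * (Real.exp (1 - r) * besselK ((N : ℝ) / 2 - 1) 1) := by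
          rw [besselProfile]
          gcongr
          exact besselK_le_exp hr _
      _ = _ := by
          rw [sub_eq_neg_add 1 r, Real.exp_add, neg_one_mul]
          ring

/-- The decaying radial solution of `Δ g = k ^ 2 g` outside a ball, normalised to be `1` on the
sphere of radius `R`, with its energy. -/
theorem exists_radial_profile {N : ℕ} (hN : 1 ≤ N) {R k : ℝ} (hR : 0 < R) (hk : 0 < k) :
    ∃ g g' : ℝ → ℝ, ContDiffOn ℝ ∞ g (Ioi 0) ∧ (∀ r, 0 < r → HasDerivAt g (g' r) r) ∧
      ContinuousOn g' (Ioi 0) ∧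
      (∀ r, 0 < r → g' r < 0) ∧ (∀ r, 0 < r → 0 < g r) ∧ g R = 1 ∧ Tendsto g atTop (𝓝 0) ∧
      ∀ M, R ≤ M → ∫ r in R..M, r ^ (N - 1) * (k ^ 2 * g r ^ 2 + g' r ^ 2) ≤
        R ^ (N - 1) * (k * besselRatio N (k * R)) := by
  set A := besselProfile N (k * R) with hA
  have hApos : 0 < A := besselProfile_pos N (mul_pos hk hR)
  have hd : ∀ r, 0 < r → HasDerivAt (fun r => besselProfile N (k * r) / A)
      (k * besselProfileDeriv N (k * r) / A) r := fun r hr => by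
    have h := (hasDerivAt_besselProfile N (mul_pos hk hr)).comp r ((hasDerivAt_id r).const_mul k)
    refine (h.div_const A).congr_deriv ?_
    ring
  have hd' : ∀ r, 0 < r → HasDerivAt (fun r => k * besselProfileDeriv N (k * r) / A)
      (k ^ 2 * (besselProfile N (k * r) / A) -
        (N - 1) / r * (k * besselProfileDeriv N (k * r) / A)) r := fun r hr => by
    have h := (hasDerivAt_besselProfileDeriv N (mul_pos hk hr)).comp r
      ((hasDerivAt_id r).const_mul k)
    refine ((h.const_mul k).div_const A).congr_deriv ?_
    field_simp
  have hg'neg : ∀ r, 0 < r → k * besselProfileDeriv N (k * r) / A < 0 := fun r hr =>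
    div_neg_of_neg_of_pos (mul_neg_of_pos_of_neg hk (besselProfileDeriv_neg N (mul_pos hk hr))) hApos
  have hgpos : ∀ r, 0 < r → 0 < besselProfile N (k * r) / A := fun r hr =>
    div_pos (besselProfile_pos N (mul_pos hk hr)) hApos
  refine ⟨fun r => besselProfile N (k * r) / A, fun r => k * besselProfileDeriv N (k * r) / A,
    ?_, hd, fun r hr => (hd' r hr).continuousAt.continuousWithinAt, hg'neg, hgpos,
    div_self hApos.ne', ?_, fun M hM => ?_⟩
  · refine ContDiffOn.div_const ((contDiffOn_besselProfile N).comp (by fun_prop) ?_) A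
    exact fun r hr => mul_pos hk hr
  · simpa using ((tendsto_besselProfile_atTop N).comp
      (tendsto_id.const_mul_atTop hk)).div_const A
  -- Since `(r ^ (N - 1) g')' = k ^ 2 r ^ (N - 1) g`, the energy density is the exact derivative of
  -- `r ^ (N - 1) g g'`. The boundary term at `M` is nonpositive and is dropped; the one at `R`
  -- gives the bound.
  · have hFTC : ∀ r, 0 < r → HasDerivAt (fun r => r ^ (N - 1) *
        (besselProfile N (k * r) / A * (k * besselProfileDeriv N (k * r) / A)))
        (r ^ (N - 1) * (k ^ 2 * (besselProfile N (k * r) / A) ^ 2 +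
          (k * besselProfileDeriv N (k * r) / A) ^ 2)) r := fun r hr => by
      refine ((hasDerivAt_pow (N - 1) r).mul ((hd r hr).mul (hd' r hr))).congr_deriv ?_
      -- For `N = 1` the truncated exponent `N - 1 - 1` is `0`, not `-1`, but both sides vanish.
      have hp : ((N - 1 : ℕ) : ℝ) * r ^ (N - 1 - 1) = (N - 1) / r * r ^ (N - 1) := by
        obtain ⟨m, rfl⟩ := Nat.exists_eq_add_of_le' hN
        rcases m with _ | m
        · simp
        · simp only [Nat.add_sub_cancel]
          push_cast
          field_simp
          ring
      rw [hp]
      simp only [Pi.mul_apply]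
      ring
    have hsub : ∀ r ∈ uIcc R M, 0 < r := fun r hr => by
      rw [uIcc_of_le hM] at hr
      exact hR.trans_le hr.1
    rw [intervalIntegral.integral_eq_sub_of_hasDerivAt (fun r hr => hFTC r (hsub r hr))]
    · have hend : M ^ (N - 1) * (besselProfile N (k * M) / A *
          (k * besselProfileDeriv N (k * M) / A)) ≤ 0 := by
        have hM0 := hR.trans_le hM
        exact mul_nonpos_of_nonneg_of_nonpos (by positivity)
          (mul_nonpos_of_nonneg_of_nonpos (hgpos M hM0).le (hg'neg M hM0).le)
      have hR' := besselProfileDeriv_div_besselProfile N (mul_pos hk hR)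
      rw [← hA] at hR'
      rw [← hA, div_self hApos.ne', one_mul, mul_div_assoc k (besselProfileDeriv N (k * R)), hR']
      linarith
    · refine ContinuousOn.intervalIntegrable fun r hr => ContinuousAt.continuousWithinAt ?_
      have h1 := (hd r (hsub r hr)).continuousAt
      have h2 := (hd' r (hsub r hr)).continuousAt
      exact (continuousAt_id.pow _).mul ((continuousAt_const.mul (h1.pow 2)).add (h2.pow 2))

/-! ### Smooth truncation of the unit interval. -/

theorem intervalIntegral_eq_zero_of_forall {k : ℝ → ℝ} {a b : ℝ} (h : ∀ t ∈ uIcc a b, k t = 0) :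
    ∫ t in a..b, k t = 0 :=
  (intervalIntegral.integral_congr (g := fun _ => (0 : ℝ)) h).trans intervalIntegral.integral_zero

/-- A smooth truncation of `max 0 (min 1 s)`, constant near `s ≤ 0` and near `1 ≤ s`. -/
theorem exists_smooth_truncation {ε : ℝ} (hε : 0 < ε) (hε' : ε < 1 / 4) :
    ∃ (η : ℝ → ℝ) (c : ℝ), ContDiff ℝ ∞ η ∧ 1 - 4 * ε ≤ c ∧ c ≤ 1 ∧ (∀ s ≤ ε, η s = 0) ∧
      (∀ s, 1 - ε ≤ s → η s = c) ∧ (∀ s, 0 ≤ s → 0 ≤ η s ∧ η s ≤ s) ∧ ∀ s, |deriv η s| ≤ 1 := by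
  -- The truncation is the primitive of a bump equal to `1` on `[2ε, 1 - 2ε]` and to `0` off `(ε, 1
  -- - ε)`. Its slope lies in `[0, 1]`, and its final value is at least the plateau length `1 - 4ε`.
  let κ : ContDiffBump (1 / 2 : ℝ) := ⟨1 / 2 - 2 * ε, 1 / 2 - ε, by linarith, by linarith⟩
  have hcont : Continuous κ := κ.continuous
  have hint : ∀ a b, IntervalIntegrable κ volume a b := fun a b => hcont.intervalIntegrable a b
  have hder : ∀ s, HasDerivAt (fun s => ∫ t in (0 : ℝ)..s, κ t) (κ s) s := fun s =>
    intervalIntegral.integral_hasDerivAt_right (hint _ _)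
      (hcont.stronglyMeasurableAtFilter _ _) hcont.continuousAt
  have hzero : ∀ t, t ≤ ε ∨ 1 - ε ≤ t → κ t = 0 := fun t ht => by
    refine κ.zero_of_le_dist ?_
    change 1 / 2 - ε ≤ _
    rw [Real.dist_eq]
    rcases ht with ht | ht
    · rw [abs_of_nonpos (by linarith)]; linarith
    · rw [abs_of_nonneg (by linarith)]; linarith
  have hone : ∀ t, 2 * ε ≤ t → t ≤ 1 - 2 * ε → κ t = 1 := fun t h1 h2 => by
    refine κ.one_of_mem_closedBall ?_
    rw [Metric.mem_closedBall, Real.dist_eq, abs_le]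
    change -(1 / 2 - 2 * ε) ≤ _ ∧ _ ≤ 1 / 2 - 2 * ε
    constructor <;> linarith
  have hle : ∀ s, 0 ≤ s → ∫ t in (0 : ℝ)..s, κ t ≤ s := fun s hs => by
    calc _ ≤ ∫ t in (0 : ℝ)..s, (1 : ℝ) :=
          intervalIntegral.integral_mono_on hs (hint _ _) (by simp) fun t _ => κ.le_one
      _ = s := by simp
  refine ⟨fun s => ∫ t in (0 : ℝ)..s, κ t, ∫ t in (0 : ℝ)..1, κ t, ?_, ?_, hle 1 zero_le_one,
    fun s hs => ?_, fun s hs => ?_, fun s hs => ⟨?_, hle s hs⟩, fun s => ?_⟩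
  · rw [contDiff_infty_iff_deriv]
    refine ⟨fun s => (hder s).differentiableAt, ?_⟩
    rw [show deriv (fun s => ∫ t in (0 : ℝ)..s, κ t) = κ from funext fun s => (hder s).deriv]
    exact κ.contDiff
  · calc 1 - 4 * ε = ∫ t in (2 * ε)..(1 - 2 * ε), (1 : ℝ) := by simp; ring
      _ = ∫ t in (2 * ε)..(1 - 2 * ε), κ t := by
        refine intervalIntegral.integral_congr fun t ht => ?_
        rw [uIcc_of_le (by linarith)] at ht
        exact (hone t ht.1 ht.2).symm
      _ ≤ ∫ t in (0 : ℝ)..1, κ t :=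
        intervalIntegral.integral_mono_interval (by linarith) (by linarith) (by linarith)
          (Eventually.of_forall fun t => κ.nonneg) (hint _ _)
  · refine intervalIntegral_eq_zero_of_forall fun t ht => hzero t (Or.inl ?_)
    rcases mem_uIcc.1 ht with h | h <;> linarith [h.1, h.2]
  · change ∫ t in (0 : ℝ)..s, κ t = _
    rw [← intervalIntegral.integral_add_adjacent_intervals (hint 0 1) (hint 1 s)]
    refine add_eq_left.2 ?_
    refine intervalIntegral_eq_zero_of_forall fun t ht => hzero t (Or.inr ?_)
    rcases mem_uIcc.1 ht with h | h <;> linarith [h.1, h.2]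
  · exact intervalIntegral.integral_nonneg hs fun t _ => κ.nonneg
  · rw [(hder s).deriv, abs_of_nonneg κ.nonneg]
    exact κ.le_one

/-! ### From distributional to classical equations in time. -/

/-- The difference of two mollifiers centred at `b` and `a` has integral zero, so its primitive is
an admissible test function. Thus the mollifications of `g` at `a` and `b` agree, and the radius
tends to `0`. Radii below `min a b` keep the supports in positive times. -/
theorem eq_of_integral_mul_deriv_eq_zero {g : ℝ → ℝ} (hg : Continuous g)
    (h : ∀ θ : ℝ → ℝ, ContDiff ℝ ∞ θ → HasCompactSupport θ → tsupport θ ⊆ Ioi 0 →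
      ∫ t, g t * deriv θ t = 0) {a b : ℝ} (ha : 0 < a) (hb : 0 < b) : g a = g b := by
  let φ : ℕ → ContDiffBump (0 : ℝ) := fun n =>
    ⟨min a b / (2 * (n + 2)), min a b / (n + 2), by positivity, by
      have : 0 < min a b := lt_min ha hb
      gcongr
      have : (0 : ℝ) ≤ n := Nat.cast_nonneg n
      linarith⟩
  have hφ : Tendsto (fun n => (φ n).rOut) atTop (𝓝 0) :=
    tendsto_const_nhds.div_atTop
      (tendsto_atTop_add_const_right _ _ tendsto_natCast_atTop_atTop)
  have hconv := fun x => ContDiffBump.convolution_tendsto_right_of_continuous (μ := volume) hφ hg x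
  refine tendsto_nhds_unique (hconv a) ((hconv b).congr fun n => ?_)
  set ρ := (φ n).normed volume with hρ
  have hρc : Continuous ρ := (φ n).continuous_normed
  have hδ : (φ n).rOut < min a b := by
    have hab : 0 < min a b := lt_min ha hb
    have : (0 : ℝ) ≤ n := Nat.cast_nonneg n
    exact div_lt_self hab (by linarith)
  set δ := (φ n).rOut with hδdef
  have hρ0 : ∀ t, δ ≤ |t| → ρ t = 0 := fun t ht => by
    by_contra hne
    have : t ∈ Function.support ρ := hne
    rw [hρ, ContDiffBump.support_normed_eq, mem_ball_zero_iff, Real.norm_eq_abs] at this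
    exact absurd this (not_lt.2 ht)
  let k : ℝ → ℝ := fun t => ρ (b - t) - ρ (a - t)
  have hk : Continuous k := by fun_prop
  have hk0 : ∀ t, t ≤ min a b - δ ∨ max a b + δ ≤ t → k t = 0 := fun t ht => by
    have hz : ∀ x, x = a ∨ x = b → δ ≤ |x - t| := fun x hx => by
      have h1 : min a b ≤ x := by rcases hx with rfl | rfl <;> simp
      have h2 : x ≤ max a b := by rcases hx with rfl | rfl <;> simp
      rcases ht with ht | ht
      · exact le_trans (by linarith) (le_abs_self _)
      · exact le_trans (by linarith) (neg_le_abs _)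
    simp [k, hρ0 _ (hz a (Or.inl rfl)), hρ0 _ (hz b (Or.inr rfl))]
  have hder : ∀ s, HasDerivAt (fun s => ∫ t in (0 : ℝ)..s, k t) (k s) s := fun s =>
    intervalIntegral.integral_hasDerivAt_right (hk.intervalIntegrable _ _)
      (hk.stronglyMeasurableAtFilter _ _) hk.continuousAt
  have hderiv : deriv (fun s => ∫ t in (0 : ℝ)..s, k t) = k := funext fun s => (hder s).deriv
  have hint : ∀ x, Integrable fun t => ρ (x - t) := fun x =>
    (φ n).integrable_normed.comp_sub_left x
  have hk_int : ∫ t, k t = 0 := by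
    rw [integral_sub (hint b) (hint a), integral_sub_left_eq_self ρ volume b,
      integral_sub_left_eq_self ρ volume a, sub_self]
  have hsupp : Function.support (fun s => ∫ t in (0 : ℝ)..s, k t) ⊆
      Icc (min a b - δ) (max a b + δ) := by
    intro s hs
    by_contra hns
    refine hs ?_
    rw [mem_Icc, not_and_or, not_le, not_le] at hns
    rcases hns with hs' | hs'
    · refine intervalIntegral_eq_zero_of_forall fun t ht => hk0 t (Or.inl ?_)
      rcases mem_uIcc.1 ht with h | h <;> linarith [h.1, h.2]
    · change ∫ t in (0 : ℝ)..s, k t = 0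
      rw [← hk_int]
      refine intervalIntegral.integral_eq_integral_of_support_subset fun t ht => ?_
      by_contra hnt
      refine ht (hk0 t ?_)
      rw [mem_Ioc, not_and_or, not_lt, not_le] at hnt
      rcases hnt with h | h
      · left; linarith
      · right; linarith
  have htsupp : tsupport (fun s => ∫ t in (0 : ℝ)..s, k t) ⊆ Icc (min a b - δ) (max a b + δ) :=
    closure_minimal hsupp isClosed_Icc
  have key := h (fun s => ∫ t in (0 : ℝ)..s, k t) ?_
    (isCompact_Icc.of_isClosed_subset (isClosed_tsupport _) htsupp)
    (htsupp.trans fun t ht => lt_of_lt_of_le (by linarith) ht.1)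
  · rw [hderiv] at key
    have hcv : ∀ x, (convolution ρ g (ContinuousLinearMap.lsmul ℝ ℝ) volume) x =
        ∫ t, g t * ρ (x - t) := fun x => by
      rw [convolution_lsmul_swap]
      simp only [smul_eq_mul, mul_comm]
    have hgint : ∀ x, Integrable fun t => g t * ρ (x - t) := fun x => by
      refine (hg.mul (by fun_prop)).integrable_of_hasCompactSupport ?_
      have : HasCompactSupport fun t => ρ (x - t) :=
        (φ n).hasCompactSupport_normed.comp_homeomorph (Homeomorph.subLeft x)
      exact this.mul_left
    rw [hcv, hcv, ← sub_eq_zero, ← integral_sub (hgint b) (hgint a), ← key]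
    simp only [k, mul_sub]
  · rw [contDiff_infty_iff_deriv, hderiv]
    refine ⟨fun s => (hder s).differentiableAt, ?_⟩
    have : ContDiff ℝ ∞ ρ := (φ n).contDiff_normed
    fun_prop

/-- A continuous solution of `A' = -B` in the sense of distributions on `(0, ∞)` is a classical
one. -/
theorem sub_eq_neg_integral_of_distributional {A B : ℝ → ℝ} (hA : Continuous A) (hB : Continuous B)
    (h : ∀ θ : ℝ → ℝ, ContDiff ℝ ∞ θ → HasCompactSupport θ → tsupport θ ⊆ Ioi 0 →
      ∫ t, (A t * deriv θ t - B t * θ t) = 0) {T : ℝ} (hT : 0 < T) :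
    A T - A 0 = -∫ t in (0 : ℝ)..T, B t := by
  have hder : ∀ s, HasDerivAt (fun s => ∫ t in (0 : ℝ)..s, B t) (B s) s := fun s =>
    intervalIntegral.integral_hasDerivAt_right (hB.intervalIntegrable _ _)
      (hB.stronglyMeasurableAtFilter _ _) hB.continuousAt
  have hI : Continuous fun s => ∫ t in (0 : ℝ)..s, B t :=
    continuous_iff_continuousAt.2 fun s => (hder s).continuousAt
  have hAI : Continuous fun t => A t + ∫ s in (0 : ℝ)..t, B s := hA.add hI
  have hconst : ∀ t, 0 < t → A t + ∫ s in (0 : ℝ)..t, B s = A T + ∫ s in (0 : ℝ)..T, B s := by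
    intro t ht
    refine eq_of_integral_mul_deriv_eq_zero hAI (fun θ hθ hθc hθs => ?_) ht hT
    have hθ' : Continuous (deriv θ) := hθ.continuous_deriv (by simp)
    have i1 : Integrable fun t => A t * deriv θ t :=
      (hA.mul hθ').integrable_of_hasCompactSupport hθc.deriv.mul_left
    have i2 : Integrable fun t => B t * θ t :=
      (hB.mul hθ.continuous).integrable_of_hasCompactSupport hθc.mul_left
    have i3 : Integrable fun t => (∫ s in (0 : ℝ)..t, B s) * deriv θ t :=
      (hI.mul hθ').integrable_of_hasCompactSupport hθc.deriv.mul_left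
    have i4 : Integrable fun t => (∫ s in (0 : ℝ)..t, B s) * θ t :=
      (hI.mul hθ.continuous).integrable_of_hasCompactSupport hθc.mul_left
    have hparts := integral_mul_deriv_eq_deriv_mul_of_integrable (fun t _ => hder t)
      (fun t _ => (hθ.differentiable (by simp) t).hasDerivAt) i3 i2 i4
    have h0 := h θ hθ hθc hθs
    rw [integral_sub i1 i2] at h0
    simp only [add_mul]
    rw [integral_add i1 i3, hparts]
    linarith
  -- Test functions see only positive times; continuity carries the constant value of `A + ∫ B` down
  -- to time `0`.
  have hlim : Tendsto (fun t => A t + ∫ s in (0 : ℝ)..t, B s) (𝓝[>] 0) (𝓝 (A 0)) := by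
    have := (hAI.tendsto 0).mono_left (nhdsWithin_le_nhds (s := Ioi 0))
    simpa using this
  have hev : (fun t => A t + ∫ s in (0 : ℝ)..t, B s) =ᶠ[𝓝[>] 0]
      fun _ => A T + ∫ s in (0 : ℝ)..T, B s := eventually_mem_nhdsWithin.mono hconst
  have := tendsto_nhds_unique tendsto_const_nhds (hlim.congr' hev)
  linarith

/-! ### The balance law integrated against a spatial cutoff. -/

theorem continuous_integral_of_hasCompactSupport {N : ℕ} {G : ℝ → Space N → ℝ}
    (hG : Continuous (Function.uncurry G)) {K : Set (Space N)} (hK : IsCompact K)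
    (h0 : ∀ t x, x ∉ K → G t x = 0) : Continuous fun t => ∫ x, G t x := by
  have h : ∀ t, ∫ x, G t x = ∫ x in K, G t x := fun t =>
    (setIntegral_eq_integral_of_forall_compl_eq_zero fun x hx => h0 t x hx).symm
  simp only [h]
  exact continuous_parametric_integral_of_continuous hG hK

/-- For product test functions `χ(x) θ(t)`, Fubini turns the balance law into `A' = -B` in the sense
of distributions, with `A = ∫ e χ` and `B = ∫ (∇χ · f + d χ)` continuous up to time `0`. -/
theorem integral_balance {N : ℕ} {e : Space N → ℝ≥0 → ℝ} {f : Space N → ℝ≥0 → Space N}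
    {d : Space N → ℝ≥0 → ℝ} (he : Continuous (Function.uncurry e))
    (hf : Continuous (Function.uncurry f)) (hd : Continuous (Function.uncurry d))
    (h : DistributionalBalance e f d) {χ : Space N → ℝ} (hχ : ContDiff ℝ ∞ χ)
    (hχc : HasCompactSupport χ) {T : ℝ} (hT : 0 < T) :
    (∫ x, e x T.toNNReal * χ x) - ∫ x, e x 0 * χ x =
      -∫ t in (0 : ℝ)..T, ∫ x, (fderiv ℝ χ x (f x t.toNNReal) + d x t.toNNReal * χ x) := by
  have hχ' : Continuous (fderiv ℝ χ) := hχ.continuous_fderiv (by simp)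
  have he' : Continuous fun p : ℝ × Space N => e p.2 p.1.toNNReal :=
    he.comp (continuous_snd.prodMk (continuous_real_toNNReal.comp continuous_fst))
  have hf' : Continuous fun p : ℝ × Space N => f p.2 p.1.toNNReal :=
    hf.comp (continuous_snd.prodMk (continuous_real_toNNReal.comp continuous_fst))
  have hd' : Continuous fun p : ℝ × Space N => d p.2 p.1.toNNReal :=
    hd.comp (continuous_snd.prodMk (continuous_real_toNNReal.comp continuous_fst))
  have hχ0 : ∀ x, x ∉ tsupport χ → χ x = 0 := fun x hx => image_eq_zero_of_notMem_tsupport hx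
  have hχ0' : ∀ x, x ∉ tsupport χ → fderiv ℝ χ x = 0 := fun x hx =>
    image_eq_zero_of_notMem_tsupport fun hx' => hx (tsupport_fderiv_subset ℝ hx')
  have cA : Continuous fun p : ℝ × Space N => e p.2 p.1.toNNReal * χ p.2 :=
    he'.mul (hχ.continuous.comp continuous_snd)
  have cB : Continuous fun p : ℝ × Space N =>
      fderiv ℝ χ p.2 (f p.2 p.1.toNNReal) + d p.2 p.1.toNNReal * χ p.2 :=
    ((hχ'.comp continuous_snd).clm_apply hf').add (hd'.mul (hχ.continuous.comp continuous_snd))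
  have hA : Continuous fun t : ℝ => ∫ x, e x t.toNNReal * χ x :=
    continuous_integral_of_hasCompactSupport (G := fun t x => e x t.toNNReal * χ x)
      cA hχc fun t x hx => by simp [hχ0 x hx]
  have hB : Continuous fun t : ℝ =>
      ∫ x, (fderiv ℝ χ x (f x t.toNNReal) + d x t.toNNReal * χ x) :=
    continuous_integral_of_hasCompactSupport
      (G := fun t x => fderiv ℝ χ x (f x t.toNNReal) + d x t.toNNReal * χ x)
      cB hχc fun t x hx => by simp [hχ0 x hx, hχ0' x hx]
  have key := sub_eq_neg_integral_of_distributional hA hB (fun θ hθ hθc hθs => ?_) hT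
  · simpa using key
  have hθ' : Continuous (deriv θ) := hθ.continuous_deriv (by simp)
  have hθ0 : ∀ t, t ∉ tsupport θ → θ t = 0 := fun t ht => image_eq_zero_of_notMem_tsupport ht
  have hθ0' : ∀ t, t ∉ tsupport θ → deriv θ t = 0 := fun t ht =>
    image_eq_zero_of_notMem_tsupport fun ht' => ht (tsupport_deriv_subset ht')
  have hsub : tsupport (fun p : Space N × ℝ => χ p.1 * θ p.2) ⊆ tsupport χ ×ˢ tsupport θ := by
    refine closure_minimal (fun p hp => ?_) ((isClosed_tsupport _).prod (isClosed_tsupport _))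
    exact ⟨subset_tsupport _ (left_ne_zero_of_mul hp), subset_tsupport _ (right_ne_zero_of_mul hp)⟩
  have hbal := h (fun p => χ p.1 * θ p.2) (by fun_prop)
    ((hχc.prod hθc).of_isClosed_subset (isClosed_tsupport _) hsub)
    (fun p hp => hθs (hsub hp).2)
  have hfd : ∀ (p : Space N × ℝ) (v : Space N) (s : ℝ),
      fderiv ℝ (fun p : Space N × ℝ => χ p.1 * θ p.2) p (v, s) =
        χ p.1 * deriv θ p.2 * s + fderiv ℝ χ p.1 v * θ p.2 := fun p v s => by
    have h1 : HasFDerivAt (fun p : Space N × ℝ => χ p.1) _ p :=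
      (hχ.differentiable (by simp) p.1).hasFDerivAt.comp p hasFDerivAt_fst
    have h2 : HasFDerivAt (fun p : Space N × ℝ => θ p.2) _ p :=
      (hθ.differentiable (by simp) p.2).hasDerivAt.hasFDerivAt.comp p hasFDerivAt_snd
    have h3 : HasFDerivAt (fun p : Space N × ℝ => χ p.1 * θ p.2) _ p := h1.mul h2
    rw [h3.fderiv]
    simp
    ring
  simp only [hfd, mul_one, mul_zero, zero_add, map_zero, zero_mul, add_zero] at hbal
  rw [setIntegral_eq_integral_of_forall_compl_eq_zero] at hbal
  · rw [Measure.volume_eq_prod, integral_prod_symm] at hbal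
    · rw [← hbal]
      congr 1
      ext t
      have i1 : Integrable fun x => e x t.toNNReal * χ x :=
        (cA.comp (Continuous.prodMk_right t)).integrable_of_hasCompactSupport hχc.mul_left
      have i2 : Integrable fun x => fderiv ℝ χ x (f x t.toNNReal) + d x t.toNNReal * χ x :=
        (cB.comp (Continuous.prodMk_right t)).integrable_of_hasCompactSupport
          (HasCompactSupport.intro hχc fun x hx => by simp [hχ0 x hx, hχ0' x hx])
      rw [← integral_mul_const, ← integral_mul_const, ← integral_sub (i1.mul_const _)
        (i2.mul_const _)]
      congr 1
      ext x
      ring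
    · refine Continuous.integrable_of_hasCompactSupport ?_
        (HasCompactSupport.intro (hχc.prod hθc) fun p hp => ?_)
      · have hA2 := cA.comp continuous_swap
        have hB2 := cB.comp continuous_swap
        have : Continuous fun p : Space N × ℝ => e p.1 p.2.toNNReal * χ p.1 * deriv θ p.2 -
            (fderiv ℝ χ p.1 (f p.1 p.2.toNNReal) + d p.1 p.2.toNNReal * χ p.1) * θ p.2 := (hA2.mul (hθ'.comp continuous_snd)).sub
          (hB2.mul (hθ.continuous.comp continuous_snd))
        refine this.congr fun p => ?_
        ring
      · rw [mem_prod, not_and_or] at hp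
        rcases hp with hp | hp
        · simp [hχ0 _ hp, hχ0' _ hp]
        · simp [hθ0 _ hp, hθ0' _ hp]
  · intro p hp
    have hp2 : p.2 ∉ tsupport θ := fun hp2 => hp ⟨mem_univ _, hθs hp2⟩
    simp [hθ0 _ hp2, hθ0' _ hp2]

/-- The dissipation in a ball is controlled by the energy of a cutoff function. -/
theorem dissipation_le_of_cutoff {N : ℕ} {e : Space N → ℝ≥0 → ℝ} {f : Space N → ℝ≥0 → Space N}
    {d : Space N → ℝ≥0 → ℝ} (he : Continuous (Function.uncurry e))
    (hf : Continuous (Function.uncurry f)) (hd : Continuous (Function.uncurry d))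
    (h : DistributionalBalance e f d) {e₀ β : ℝ} (hβ : 0 ≤ β) (he0 : ∀ x t, 0 ≤ e x t)
    (hd0 : ∀ x t, 0 ≤ d x t) (hee : ∀ x, e x 0 ≤ e₀) (hfd : ∀ x t, ‖f x t‖ ^ 2 ≤ β * d x t)
    {p : Space N → ℝ} (hp : ContDiff ℝ ∞ p) (hpc : HasCompactSupport p) {c R T : ℝ}
    (hR : 0 < R) (hpR : ∀ x ∈ Metric.ball (0 : Space N) R, p x = c) (hT : 0 < T) :
    c ^ 2 * ∫ t in (0 : ℝ)..T, ∫ x in Metric.ball (0 : Space N) R, d x t.toNNReal ≤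
      ∫ x, (e₀ * p x ^ 2 + β * T * ‖fderiv ℝ p x‖ ^ 2) := by
  have hp' : Continuous (fderiv ℝ p) := hp.continuous_fderiv (by simp)
  have hp2c : HasCompactSupport fun x => p x ^ 2 := by
    simp only [pow_two]
    exact hpc.mul_left
  have hfd2 : ∀ x v, fderiv ℝ (fun x => p x ^ 2) x v = 2 * p x * fderiv ℝ p x v := fun x v => by
    rw [((hp.differentiable (by simp) x).hasFDerivAt.pow 2).fderiv]
    simp
  have key := integral_balance he hf hd h (χ := fun x => p x ^ 2) (by fun_prop) hp2c hT
  simp only [hfd2] at key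
  have hf' : Continuous fun p : ℝ × Space N => f p.2 p.1.toNNReal :=
    hf.comp (continuous_snd.prodMk (continuous_real_toNNReal.comp continuous_fst))
  have hd' : Continuous fun p : ℝ × Space N => d p.2 p.1.toNNReal :=
    hd.comp (continuous_snd.prodMk (continuous_real_toNNReal.comp continuous_fst))
  have hp0 : ∀ x, x ∉ tsupport p → p x = 0 := fun x hx => image_eq_zero_of_notMem_tsupport hx
  have cB : Continuous fun q : ℝ × Space N =>
      2 * p q.2 * fderiv ℝ p q.2 (f q.2 q.1.toNNReal) + d q.2 q.1.toNNReal * p q.2 ^ 2 :=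
    ((continuous_const.mul (hp.continuous.comp continuous_snd)).mul
      ((hp'.comp continuous_snd).clm_apply hf')).add
      (hd'.mul ((hp.continuous.comp continuous_snd).pow 2))
  have hB : Continuous fun t : ℝ =>
      ∫ x, (2 * p x * fderiv ℝ p x (f x t.toNNReal) + d x t.toNNReal * p x ^ 2) :=
    continuous_integral_of_hasCompactSupport
      (G := fun t x => 2 * p x * fderiv ℝ p x (f x t.toNNReal) + d x t.toNNReal * p x ^ 2)
      cB hpc fun t x hx => by simp [hp0 x hx]
  have hdball : ∀ t : ℝ, IntegrableOn (fun x => d x t.toNNReal) (Metric.ball (0 : Space N) R) :=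
    fun t => ((hd'.comp (Continuous.prodMk_right t)).continuousOn.integrableOn_compact
      (isCompact_closedBall (0 : Space N) R)).mono_set Metric.ball_subset_closedBall
  have i1 : Integrable fun x => p x ^ 2 := (hp.continuous.pow 2).integrable_of_hasCompactSupport hp2c
  have i2 : Integrable fun x => ‖fderiv ℝ p x‖ ^ 2 :=
    (hp'.norm.pow 2).integrable_of_hasCompactSupport (by
      simp only [pow_two]
      exact (hpc.fderiv ℝ).norm.mul_left)
  have i3 : Integrable fun x => e x 0 * p x ^ 2 :=
    ((he.comp (Continuous.prodMk_left 0)).mul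
      (hp.continuous.pow 2)).integrable_of_hasCompactSupport hp2c.mul_left
  have hpt : ∀ (t : ℝ), c ^ 2 * ∫ x in Metric.ball (0 : Space N) R, d x t.toNNReal ≤
      (∫ x, (2 * p x * fderiv ℝ p x (f x t.toNNReal) + d x t.toNNReal * p x ^ 2)) +
        β * ∫ x, ‖fderiv ℝ p x‖ ^ 2 := fun t => by
    have i4 : Integrable fun x =>
        2 * p x * fderiv ℝ p x (f x t.toNNReal) + d x t.toNNReal * p x ^ 2 :=
      (cB.comp (Continuous.prodMk_right t)).integrable_of_hasCompactSupport
        (HasCompactSupport.intro hpc fun x hx => by simp [hp0 x hx])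
    rw [← integral_const_mul, ← integral_const_mul, ← integral_indicator measurableSet_ball,
      ← integral_add i4 (i2.const_mul β)]
    refine integral_mono ((integrable_indicator_iff measurableSet_ball).2 ((hdball t).const_mul _))
      (i4.add (i2.const_mul β)) fun x => ?_
    by_cases hx : x ∈ Metric.ball (0 : Space N) R
    -- Inside the ball the cutoff is constant, so the flux term disappears and the whole dissipation
    -- is kept.
    · have hz : fderiv ℝ p x = 0 := by
        have : p =ᶠ[𝓝 x] fun _ => c :=
          Filter.eventually_of_mem (Metric.isOpen_ball.mem_nhds hx) hpR
        rw [this.fderiv_eq, fderiv_const_apply]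
      simp [hx, hz, hpR x hx, mul_comm]
    · rw [indicator_of_notMem hx]
      set L := fderiv ℝ p x with hL
      set v := f x t.toNNReal with hv
      set q := √(d x t.toNNReal) with hq
      set s := √β with hs
      have hq2 : q ^ 2 = d x t.toNNReal := Real.sq_sqrt (hd0 _ _)
      have hs2 : s ^ 2 = β := Real.sq_sqrt hβ
      have hvs : ‖v‖ ≤ s * q := by
        refine (sq_le_sq₀ (norm_nonneg _) (by positivity)).1 ?_
        rw [mul_pow, hq2, hs2]
        exact hfd _ _
      have hLv : |L v| ≤ ‖L‖ * (s * q) :=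
        (L.le_opNorm v).trans (mul_le_mul_of_nonneg_left hvs (norm_nonneg _))
      have hpLv : -(|p x| * (‖L‖ * (s * q))) ≤ p x * L v := by
        refine neg_le_of_abs_le ?_
        rw [abs_mul]
        gcongr
      rw [← hq2, ← hs2, ← sq_abs (p x)]
      -- Completing the square: `d p ^ 2 - 2 √(β d) |p| ‖∇p‖ + β ‖∇p‖ ^ 2 ≥ 0`.
      nlinarith [sq_nonneg (q * |p x| - s * ‖L‖)]
  -- The sphere is a null set, so the open ball may be replaced by the compact closed ball, where
  -- parametric continuity applies.
  have hcD : Continuous fun t : ℝ => ∫ x in Metric.ball (0 : Space N) R, d x t.toNNReal := by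
    have : ∀ t : ℝ, ∫ x in Metric.ball (0 : Space N) R, d x t.toNNReal =
        ∫ x in Metric.closedBall (0 : Space N) R, d x t.toNNReal := fun t => by
      rw [← Metric.ball_union_sphere]
      exact setIntegral_congr_set (union_ae_eq_left_of_ae_eq_empty
        (ae_eq_empty.2 (Measure.addHaar_sphere_of_ne_zero _ _ hR.ne'))).symm
    simp only [this]
    exact continuous_parametric_integral_of_continuous
      (f := fun t x => d x (Real.toNNReal t)) hd' (isCompact_closedBall _ _)
  have hint : ∫ t in (0 : ℝ)..T, c ^ 2 * ∫ x in Metric.ball (0 : Space N) R, d x t.toNNReal ≤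
      ∫ t in (0 : ℝ)..T, ((∫ x, (2 * p x * fderiv ℝ p x (f x t.toNNReal) +
        d x t.toNNReal * p x ^ 2)) + β * ∫ x, ‖fderiv ℝ p x‖ ^ 2) :=
    intervalIntegral.integral_mono_on hT.le ((hcD.const_mul _).intervalIntegrable _ _)
      ((hB.add continuous_const).intervalIntegrable _ _) fun t _ => hpt t
  rw [intervalIntegral.integral_const_mul, intervalIntegral.integral_add
    (hB.intervalIntegrable _ _) (by simp), intervalIntegral.integral_const, sub_zero,
    smul_eq_mul] at hint
  have hend : 0 ≤ ∫ x, e x T.toNNReal * p x ^ 2 :=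
    integral_nonneg fun x => mul_nonneg (he0 _ _) (sq_nonneg _)
  have hstart : ∫ x, e x 0 * p x ^ 2 ≤ e₀ * ∫ x, p x ^ 2 := by
    rw [← integral_const_mul]
    exact integral_mono i3 (i1.const_mul _) fun x =>
      mul_le_mul_of_nonneg_right (hee x) (sq_nonneg _)
  rw [integral_add (i1.const_mul _) (i2.const_mul _), integral_const_mul, integral_const_mul]
  linarith

/-! ### Construction of the almost optimal cutoff. -/

/-- Polar coordinates, with sphere area `N` times the unit ball volume. The integrand is the
piecewise radial majorant of the energy density of the cutoff: constant inside the ball, profile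
energy on the shell, zero beyond `M`. -/
theorem integrable_and_integral_radial_le {N : ℕ} (hN : 1 ≤ N) {R M a C : ℝ} (hR : 0 < R)
    (hM : R ≤ M) {q : ℝ → ℝ} (hq : ContinuousOn q (Icc R M))
    (hqC : ∫ r in R..M, r ^ (N - 1) * q r ≤ C) :
    Integrable (fun x : Space N => (Iio R).indicator (fun _ => a) ‖x‖ + (Icc R M).indicator q ‖x‖) ∧
      ∫ x : Space N, ((Iio R).indicator (fun _ => a) ‖x‖ + (Icc R M).indicator q ‖x‖) ≤
        volume.real (Metric.ball (0 : Space N) 1) * (R ^ N * a + N * C) := by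
  have : Nonempty (Fin N) := ⟨⟨0, hN⟩⟩
  have hdim : Module.finrank ℝ (Space N) = N := by simp
  have hN0 : (N : ℝ) ≠ 0 := Nat.cast_ne_zero.2 (by omega)
  have hsplit : ∀ y ∈ Ioi (0 : ℝ), y ^ (N - 1) • ((Iio R).indicator (fun _ => a) y +
      (Icc R M).indicator q y) = (Ioo 0 R).indicator (fun y => y ^ (N - 1) * a) y +
        (Icc R M).indicator (fun y => y ^ (N - 1) * q y) y := fun y hy => by
    have h1 : y ∈ Ioo 0 R ↔ y ∈ Iio R := ⟨fun h => h.2, fun h => ⟨hy, h⟩⟩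
    by_cases h : y ∈ Iio R <;> by_cases h' : y ∈ Icc R M <;>
      simp only [indicator, h, h', h1, if_true, if_false, smul_eq_mul] <;> ring
  have j1 : IntegrableOn (fun y : ℝ => y ^ (N - 1) * a) (Ioo 0 R) :=
    ((by fun_prop : Continuous fun y : ℝ => y ^ (N - 1) * a).continuousOn.integrableOn_compact
      isCompact_Icc).mono_set Ioo_subset_Icc_self
  have j2 : IntegrableOn (fun y : ℝ => y ^ (N - 1) * q y) (Icc R M) :=
    ((continuousOn_id.pow _).mul hq).integrableOn_compact isCompact_Icc
  have k1 := (integrable_indicator_iff measurableSet_Ioo).2 j1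
  have k2 := (integrable_indicator_iff measurableSet_Icc).2 j2
  have hIcc : Icc R M ⊆ Ioi 0 := fun y hy => hR.trans_le hy.1
  constructor
  · refine (integrable_fun_norm_addHaar (volume : Measure (Space N))
      (f := fun y => (Iio R).indicator (fun _ => a) y + (Icc R M).indicator q y)).2 ?_
    rw [hdim]
    exact ((k1.add k2).integrableOn).congr_fun (fun y hy => (hsplit y hy).symm) measurableSet_Ioi
  · rw [integral_fun_norm_addHaar volume
      (fun y => (Iio R).indicator (fun _ => a) y + (Icc R M).indicator q y), hdim,
      setIntegral_congr_fun measurableSet_Ioi hsplit,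
      integral_add k1.integrableOn k2.integrableOn, setIntegral_indicator measurableSet_Ioo,
      setIntegral_indicator measurableSet_Icc,
      inter_eq_self_of_subset_right Ioo_subset_Ioi_self,
      inter_eq_self_of_subset_right hIcc,
      ← integral_Ioc_eq_integral_Ioo, ← intervalIntegral.integral_of_le hR.le,
      integral_Icc_eq_integral_Ioc, ← intervalIntegral.integral_of_le hM,
      intervalIntegral.integral_mul_const, integral_pow]
    have hc : ((N - 1 : ℕ) : ℝ) + 1 = N := by
      rw [Nat.cast_sub hN]; simp
    rw [Nat.sub_add_cancel hN, hc, zero_pow (by omega), sub_zero, nsmul_eq_mul, smul_eq_mul]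
    calc (N : ℝ) * (volume.real (Metric.ball (0 : Space N) 1) *
          (R ^ N / N * a + ∫ r in R..M, r ^ (N - 1) * q r))
        ≤ N * (volume.real (Metric.ball (0 : Space N) 1) * (R ^ N / N * a + C)) := by
          gcongr
      _ = _ := by field_simp

/-- A smooth compactly supported cutoff, constant and almost `1` on the ball of radius `R`, with
almost minimal energy `∫ k² p² + |∇p|²`. -/
theorem exists_cutoff {N : ℕ} (hN : 1 ≤ N) {R k ε : ℝ} (hR : 0 < R) (hk : 0 < k) (hε : 0 < ε)
    (hε' : ε < 1 / 4) :
    ∃ (p : Space N → ℝ) (c : ℝ), ContDiff ℝ ∞ p ∧ HasCompactSupport p ∧ 1 - 4 * ε ≤ c ∧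
      (∀ x ∈ Metric.ball (0 : Space N) R, p x = c) ∧
      ∫ x, (k ^ 2 * p x ^ 2 + ‖fderiv ℝ p x‖ ^ 2) ≤
        volume.real (Metric.ball (0 : Space N) 1) *
          (R ^ N * k ^ 2 + N * (R ^ (N - 1) * (k * besselRatio N (k * R)))) := by
  obtain ⟨g, g', hg, hgd, hg'c, hg'neg, hgpos, hgR, hglim, hgE⟩ := exists_radial_profile hN hR hk
  obtain ⟨η, c, hη, hc, hc1, hη0, hη1, hηle, hη'⟩ := exists_smooth_truncation hε hε'
  have hanti : StrictAntiOn g (Ioi 0) :=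
    strictAntiOn_of_deriv_neg (convex_Ioi 0)
      (fun r hr => (hgd r hr).continuousAt.continuousWithinAt) fun r hr => by
        rw [interior_Ioi] at hr
        rw [(hgd r hr).deriv]
        exact hg'neg r hr
  obtain ⟨M, hMR, hM⟩ : ∃ M, R ≤ M ∧ ∀ r, M ≤ r → g r ≤ ε := by
    obtain ⟨M, hM⟩ := eventually_atTop.1 (hglim.eventually (eventually_le_nhds hε))
    exact ⟨max R M, le_max_left _ _, fun r hr => hM r ((le_max_right _ _).trans hr)⟩
  -- As `g` decreases with `g R = 1`, `η ∘ g` already equals `c` near the sphere, so the two pieces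
  -- join smoothly; it vanishes once `g ≤ ε`, which gives compact support.
  let p : Space N → ℝ := fun x => if ‖x‖ < R then c else η (g ‖x‖)
  have hin : ∀ x : Space N, ‖x‖ < R → p =ᶠ[𝓝 x] fun _ => c := fun x hx => by
    filter_upwards [continuous_norm.continuousAt.eventually (eventually_lt_nhds hx)] with y hy
    exact if_pos hy
  have hout : ∀ x : Space N, R ≤ ‖x‖ → p =ᶠ[𝓝 x] fun y => η (g ‖y‖) := fun x hx => by
    filter_upwards [continuous_norm.continuousAt.eventually
      (eventually_gt_nhds (hR.trans_le hx))] with y hy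
    by_cases hyR : ‖y‖ < R
    · have : 1 < g ‖y‖ := hgR ▸ hanti hy hR hyR
      simp only [p, if_pos hyR]
      exact (hη1 _ (by linarith)).symm
    · exact if_neg hyR
  have hp : ContDiff ℝ ∞ p := by
    refine contDiff_iff_contDiffAt.2 fun x => ?_
    rcases lt_or_ge ‖x‖ R with hx | hx
    · exact contDiffAt_const.congr_of_eventuallyEq (hin x hx)
    · have hx0 : 0 < ‖x‖ := hR.trans_le hx
      refine ContDiffAt.congr_of_eventuallyEq ?_ (hout x hx)
      have h1 : ContDiffAt ℝ ∞ g ‖x‖ := hg.contDiffAt (Ioi_mem_nhds hx0)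
      exact hη.contDiffAt.comp x (h1.comp x (contDiffAt_norm ℝ (norm_pos_iff.1 hx0)))
  have hpM : ∀ x : Space N, M ≤ ‖x‖ → p x = 0 := fun x hx =>
    (if_neg (not_lt.2 (hMR.trans hx))).trans (hη0 _ (hM _ hx))
  have hfin : ∀ x : Space N, ‖x‖ < R → fderiv ℝ p x = 0 := fun x hx => by
    rw [(hin x hx).fderiv_eq, fderiv_const_apply]
  have hfout : ∀ x : Space N, R ≤ ‖x‖ → ‖fderiv ℝ p x‖ ^ 2 ≤ g' ‖x‖ ^ 2 := fun x hx => by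
    have hx0 : 0 < ‖x‖ := hR.trans_le hx
    have h1 : HasDerivAt (fun r => η (g r)) (deriv η (g ‖x‖) * g' ‖x‖) ‖x‖ :=
      ((hη.differentiable (by simp) _).hasDerivAt).comp _ (hgd _ hx0)
    have h2 : DifferentiableAt ℝ (fun y : Space N => ‖y‖) x :=
      (contDiffAt_norm (n := 1) ℝ (norm_pos_iff.1 hx0)).differentiableAt (by simp)
    have h3 : HasFDerivAt (fun y : Space N => η (g ‖y‖)) _ x :=
      h1.comp_hasFDerivAt x h2.hasFDerivAt
    have h4 : ‖fderiv ℝ (fun y : Space N => ‖y‖) x‖ ≤ 1 := by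
      simpa using norm_fderiv_le_of_lipschitz ℝ (x₀ := x) (lipschitzWith_one_norm (E := Space N))
    rw [(hout x hx).fderiv_eq, h3.fderiv, norm_smul, norm_mul, ← sq_abs (g' ‖x‖)]
    refine pow_le_pow_left₀ (by positivity) ?_ 2
    calc ‖deriv η (g ‖x‖)‖ * ‖g' ‖x‖‖ * ‖fderiv ℝ (fun y : Space N => ‖y‖) x‖
        ≤ 1 * ‖g' ‖x‖‖ * 1 := by
          gcongr
          exact hη' _
      _ = _ := by simp
  have hfM : ∀ x : Space N, M < ‖x‖ → fderiv ℝ p x = 0 := fun x hx => by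
    have : p =ᶠ[𝓝 x] fun _ => 0 := by
      filter_upwards [continuous_norm.continuousAt.eventually (eventually_gt_nhds hx)] with y hy
      exact hpM y hy.le
    rw [this.fderiv_eq, fderiv_const_apply]
  have hIcc : Icc R M ⊆ Ioi 0 := fun r hr => hR.trans_le hr.1
  obtain ⟨hG, hGle⟩ := integrable_and_integral_radial_le hN (a := k ^ 2)
    (q := fun r => k ^ 2 * g r ^ 2 + g' r ^ 2) hR hMR
    ((continuousOn_const.mul ((hg.continuousOn.mono hIcc).pow 2)).add
      ((hg'c.mono hIcc).pow 2)) (hgE M hMR)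
  refine ⟨p, c, hp, HasCompactSupport.intro (isCompact_closedBall 0 M) fun x hx => hpM x ?_, hc,
    fun x hx => if_pos (mem_ball_zero_iff.1 hx), le_trans ?_ hGle⟩
  · rw [mem_closedBall_zero_iff, not_le] at hx
    exact hx.le
  -- Pointwise comparison with the untruncated profile: `c ≤ 1` inside, `η s ≤ s` and `|η'| ≤ 1` on
  -- the shell, and zero beyond `M`.
  refine integral_mono_of_nonneg (Eventually.of_forall fun x => by positivity) hG
    (Eventually.of_forall fun x => ?_)
  dsimp only
  have hc0 : 0 ≤ c := by linarith
  rcases lt_or_ge ‖x‖ R with hx | hx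
  · have h1 : ‖x‖ ∈ Iio R := hx
    have h2 : ‖x‖ ∉ Icc R M := fun h => absurd h.1 (not_le.2 hx)
    have h3 : p x = c := if_pos hx
    rw [indicator_of_mem h1, indicator_of_notMem h2, hfin x hx, h3]
    have : c ^ 2 ≤ 1 := pow_le_one₀ hc0 hc1
    simp only [norm_zero]
    nlinarith [sq_nonneg k]
  · have h1 : ‖x‖ ∉ Iio R := not_lt.2 hx
    rw [indicator_of_notMem h1, zero_add]
    rcases le_or_gt ‖x‖ M with hxM | hxM
    · have h2 : ‖x‖ ∈ Icc R M := ⟨hx, hxM⟩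
      have h3 : p x = η (g ‖x‖) := if_neg (not_lt.2 hx)
      have h4 := hηle _ (hgpos _ (hR.trans_le hx)).le
      rw [indicator_of_mem h2, h3]
      exact add_le_add (mul_le_mul_of_nonneg_left (pow_le_pow_left₀ h4.1 h4.2 2) (sq_nonneg k))
        (hfout x hx)
    · have h2 : ‖x‖ ∉ Icc R M := fun h => absurd h.2 (not_le.2 hxM)
      rw [indicator_of_notMem h2, hfM x hxM, hpM x hxM.le]
      simp

/-! ### Normalisation constants and the final estimate. -/

theorem volume_real_unit_ball_eq_sphereArea_div {N : ℕ} (hN : 1 ≤ N) :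
    volume.real (Metric.ball (0 : Space N) 1) = sphereArea N / N := by
  have : Nonempty (Fin N) := ⟨⟨0, hN⟩⟩
  have hN0 : (0 : ℝ) < N := Nat.cast_pos.2 hN
  have hΓ : 0 < Real.Gamma ((N : ℝ) / 2) := Real.Gamma_pos_of_pos (by positivity)
  rw [Measure.real, EuclideanSpace.volume_ball, Fintype.card_fin, ENNReal.ofReal_one, one_pow,
    one_mul, Real.Gamma_add_one (by positivity), ENNReal.toReal_ofReal (by positivity), sphereArea,
    Real.sqrt_eq_rpow, ← Real.rpow_natCast, ← Real.rpow_mul Real.pi_pos.le,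
    show (1 / 2 : ℝ) * N = N / 2 by ring]
  field_simp

theorem sphereArea_pos {N : ℕ} (hN : 1 ≤ N) : 0 < sphereArea N := by
  have hN0 : (0 : ℝ) < N := Nat.cast_pos.2 hN
  have hΓ : 0 < Real.Gamma ((N : ℝ) / 2) := Real.Gamma_pos_of_pos (by positivity)
  rw [sphereArea]
  positivity

theorem corollary4p2 {N : ℕ} (hN : 1 ≤ N) {X : Type*} [TopologicalSpace X]
    [TopologicalSpace.MetrizableSpace X]
    (Φ : Flow ℝ≥0 X) (e : X → C(Space N, ℝ)) (f : X → C(Space N, Space N))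
    (d : X → C(Space N, ℝ)) (b : ℝ → ℝ)
    (hsys : IsExtendedDissipativeSystem Φ e f d b)
    (u₀ : X) (e₀ β : ℝ) (he₀_pos : 0 < e₀) (hβ_pos : 0 < β)
    (he₀ : IsLUB (Set.range fun x : Space N => e u₀ x) e₀)
    (hβ : IsLUB (Set.range fun p : Space N × ℝ≥0 => b (e (Φ p.2 u₀) p.1)) β)
    (R₀ T : ℝ) (hR₀ : 0 < R₀) (hT : 0 < T) :
    N / (sphereArea N * R₀ ^ N * T ^ ((N : ℝ) / 2)) *
        ∫ t in (0 : ℝ)..T, ∫ x in Metric.ball (0 : Space N) (R₀ * √T), d (Φ t.toNNReal u₀) x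
      ≤ e₀ * (besselRatioTilde N (R₀ * √(e₀ / β)) + 1) := by
  have hΦ : Continuous fun t : ℝ≥0 => Φ t u₀ := Φ.continuous continuous_id continuous_const
  have ce : Continuous (Function.uncurry fun (x : Space N) (t : ℝ≥0) => e (Φ t u₀) x) :=
    ((hsys.continuous_e.comp hΦ).comp continuous_snd).eval continuous_fst
  have cf : Continuous (Function.uncurry fun (x : Space N) (t : ℝ≥0) => f (Φ t u₀) x) :=
    ((hsys.continuous_f.comp hΦ).comp continuous_snd).eval continuous_fst
  have cd : Continuous (Function.uncurry fun (x : Space N) (t : ℝ≥0) => d (Φ t u₀) x) :=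
    ((hsys.continuous_d.comp hΦ).comp continuous_snd).eval continuous_fst
  set D := ∫ t in (0 : ℝ)..T, ∫ x in Metric.ball (0 : Space N) (R₀ * √T), d (Φ t.toNNReal u₀) x
    with hD
  have hsT : 0 < √T := Real.sqrt_pos.2 hT
  have hR : 0 < R₀ * √T := mul_pos hR₀ hsT
  -- This `k` makes `e₀ p ^ 2 + β T ‖∇p‖ ^ 2` equal to `β T (k ^ 2 p ^ 2 + ‖∇p‖ ^ 2)`, and `k R₀ √T`
  -- does not depend on `T`.
  set k := √(e₀ / (β * T)) with hk_def
  have hk : 0 < k := Real.sqrt_pos.2 (by positivity)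
  have hk2 : β * T * k ^ 2 = e₀ := by
    rw [hk_def, Real.sq_sqrt (by positivity)]
    field_simp
  have hkR : k * (R₀ * √T) = R₀ * √(e₀ / β) := by
    rw [hk_def, show e₀ / β = e₀ / (β * T) * T by field_simp,
      Real.sqrt_mul (by positivity : 0 ≤ e₀ / (β * T))]
    ring
  set V := volume.real (Metric.ball (0 : Space N) 1) with hV
  set C := β * T * (V * ((R₀ * √T) ^ N * k ^ 2 +
    N * ((R₀ * √T) ^ (N - 1) * (k * besselRatio N (k * (R₀ * √T)))))) with hC
  have hbound : ∀ ε, 0 < ε → ε < 1 / 4 → (1 - 4 * ε) ^ 2 * D ≤ C := by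
    intro ε hε hε'
    obtain ⟨p, c, hp, hpc, hc, hpR, hpE⟩ := exists_cutoff hN hR hk hε hε'
    have hdis := dissipation_le_of_cutoff ce cf cd (hsys.balance u₀) hβ_pos.le
      (fun x t => hsys.e_nonneg _ _) (fun x t => hsys.d_nonneg _ _) (e₀ := e₀)
      (fun x => by
        rw [Φ.map_zero_apply]
        exact he₀.1 ⟨x, rfl⟩)
      (fun x t => (hsys.flux_bound _ _).trans
        (mul_le_mul_of_nonneg_right (hβ.1 ⟨(x, t), rfl⟩) (hsys.d_nonneg _ _))) hp hpc hR hpR hT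
    have hD0 : 0 ≤ D := intervalIntegral.integral_nonneg hT.le fun t _ =>
      integral_nonneg fun x => hsys.d_nonneg _ _
    have hE : ∫ x, (e₀ * p x ^ 2 + β * T * ‖fderiv ℝ p x‖ ^ 2) =
        β * T * ∫ x, (k ^ 2 * p x ^ 2 + ‖fderiv ℝ p x‖ ^ 2) := by
      rw [← integral_const_mul]
      congr 1
      ext x
      rw [← hk2]
      ring
    calc (1 - 4 * ε) ^ 2 * D ≤ c ^ 2 * D :=
          mul_le_mul_of_nonneg_right (pow_le_pow_left₀ (by linarith) hc 2) hD0
      _ ≤ _ := hdis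
      _ ≤ C := by
          rw [hE]
          exact mul_le_mul_of_nonneg_left hpE (by positivity)
  -- The bound `C` is independent of `ε`, so the loss in the plateau value disappears as `ε → 0`.
  have hDC : D ≤ C := by
    have hlim : Tendsto (fun ε : ℝ => (1 - 4 * ε) ^ 2 * D) (𝓝[>] 0) (𝓝 D) := by
      have : Continuous fun ε : ℝ => (1 - 4 * ε) ^ 2 * D := by fun_prop
      simpa using (this.tendsto 0).mono_left (nhdsWithin_le_nhds (s := Ioi 0))
    refine le_of_tendsto hlim ?_
    filter_upwards [Ioo_mem_nhdsGT (show (0 : ℝ) < 1 / 4 by norm_num)] with ε hε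
      using hbound ε hε.1 hε.2
  have hω := sphereArea_pos hN
  have hN0 : (0 : ℝ) < N := Nat.cast_pos.2 hN
  have hpow : T ^ ((N : ℝ) / 2) = √T ^ N := by
    rw [Real.sqrt_eq_rpow, ← Real.rpow_natCast, ← Real.rpow_mul hT.le]
    congr 1
    ring
  rw [hpow, mul_assoc, ← mul_pow]
  calc N / (sphereArea N * (R₀ * √T) ^ N) * D
      ≤ N / (sphereArea N * (R₀ * √T) ^ N) * C :=
        mul_le_mul_of_nonneg_left hDC (by positivity)
    _ = _ := by
      rw [hC, hV, volume_real_unit_ball_eq_sphereArea_div hN, besselRatioTilde, ← hkR, ← hk2]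
      obtain ⟨m, rfl⟩ := Nat.exists_eq_add_of_le' hN
      rw [Nat.add_sub_cancel, pow_succ (R₀ * √T) m]
      field_simp
      ring
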